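/- Let $F^2$ be the Fock space, i.e. the Hilbert space of all entire functions $f$ with $\|f\|^2=\int_{\mathbb C}|f|^2\,d\lambda<\infty$, where $d\lambda(z)=\frac1\pi e^{-|z|^2}\,dA(z)$, with the inner product of $L^2(\mathbb C,d\lambda)$. The Bargmann transform $$Bu(z)=\left(\frac2\pi\right)^{1/4}\int_{\mathbb R}u(x)\,e^{2xz-x^2-z^2/2}\,dx$$ is a unitary operator from $L^2(\mathbb R)$ onto $F^2$. On $L^2(\mathbb R)$ let $Tu(x)=xu(x)$, with domain all $u\in L^2(\mathbb R)$ such that $xu(x)\in L^2(\mathbb R)$, and let $Su=u'$, with domain all $u\in L^2(\mathbb R)$ whose weak derivative $u'$ is in $L^2(\mathbb R)$. Put $A_1=BTB^{-1}$ and $A_2=BSB^{-1}$, with their natural domains in $F^2$. Then a function $f\in F^2$ is in the domain of $A_2=BSB^{-1}$ if and only if $f'(z)-zf(z)$ is in $F^2$, and in this case $$BSB^{-1}f(z)=f'(z)-zf(z),\qquad z\in\mathbb C.$$ Moreover, $[S,T]=ST-TS=I$ on $L^2(\mathbb R)$ and $[A_2,A_1]=A_2A_1-A_1A_2=I$ on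 $F^2$. That is, in each case the set of all elements to which both products can be applied is dense in the space, and on this set the commutator is the identity. -/

import Mathlib

open MeasureTheory
open scoped ContDiff

namespace Bargmann

noncomputable section

/-! ### The Fock space -/

/-- The Gaussian measure `dλ(z) = π⁻¹ exp(-|z|²) dA(z)` on the complex plane. -/
def gaussianMeasure : Measure ℂ :=
  (volume : Measure ℂ).withDensity fun z => ENNReal.ofReal (Real.pi⁻¹ * Real.exp (-‖z‖ ^ 2))

/-- `f` is entire and square integrable with respect to the Gaussian measure. -/
def IsFock (f : ℂ → ℂ) : Prop :=
  Differentiable ℂ f ∧ MemLp f 2 gaussianMeasure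

/-- The Fock functions, as a linear subspace of the space of all functions. -/
def fockSubmodule : Submodule ℂ (ℂ → ℂ) where
  carrier := {f | IsFock f}
  add_mem' := fun hf hg => ⟨hf.1.add hg.1, hf.2.add hg.2⟩
  zero_mem' := ⟨differentiable_const 0, MemLp.zero⟩
  smul_mem' := fun c _ hf => ⟨hf.1.const_smul c, hf.2.const_smul c⟩

/-- The Fock space `F²`. A separate type, so that it carries the norm of `L²(ℂ, dλ)` and not
the topology of pointwise convergence. -/
def FockSpace : Type := fockSubmodule

instance : AddCommGroup FockSpace := inferInstanceAs (AddCommGroup fockSubmodule)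

instance : Module ℂ FockSpace := inferInstanceAs (Module ℂ fockSubmodule)

instance : CoeFun FockSpace (fun _ => ℂ → ℂ) := ⟨fun f => f.1⟩

theorem FockSpace.isFock (f : FockSpace) : IsFock f := f.2

/-- The inclusion of `F²` into `L²(ℂ, dλ)`. -/
def FockSpace.toLp : FockSpace →ₗ[ℂ] Lp ℂ 2 gaussianMeasure where
  toFun f := f.isFock.2.toLp f
  map_add' f g := MemLp.toLp_add f.isFock.2 g.isFock.2
  map_smul' c f := MemLp.toLp_const_smul c f.isFock.2

theorem volume_absolutelyContinuous_gaussianMeasure :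
    (volume : Measure ℂ) ≪ gaussianMeasure := by
  refine withDensity_absolutelyContinuous' ?_ ?_
  · exact (by fun_prop : Measurable fun z : ℂ =>
      ENNReal.ofReal (Real.pi⁻¹ * Real.exp (-‖z‖ ^ 2))).aemeasurable
  · refine Filter.Eventually.of_forall fun z => ?_
    have : 0 < Real.pi⁻¹ * Real.exp (-‖z‖ ^ 2) := by positivity
    simpa using this

theorem FockSpace.toLp_injective : Function.Injective FockSpace.toLp := by
  intro f g h
  have h1 : (f : ℂ → ℂ) =ᵐ[gaussianMeasure] g :=
    (MemLp.toLp_eq_toLp_iff f.isFock.2 g.isFock.2).1 h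
  have h2 : (f : ℂ → ℂ) =ᵐ[volume] g := volume_absolutelyContinuous_gaussianMeasure.ae_le h1
  exact Subtype.ext ((Continuous.ae_eq_iff_eq volume f.isFock.1.continuous g.isFock.1.continuous).1 h2)

/-- The norm of `F²` is the norm of `L²(ℂ, dλ)`. -/
instance : NormedAddCommGroup FockSpace :=
  NormedAddCommGroup.induced FockSpace (Lp ℂ 2 gaussianMeasure) FockSpace.toLp
    FockSpace.toLp_injective

/-- The inner product of `F²` is the inner product of `L²(ℂ, dλ)`. -/
instance : InnerProductSpace ℂ FockSpace where
  toNormedSpace := NormedSpace.induced ℂ FockSpace (Lp ℂ 2 gaussianMeasure) FockSpace.toLp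
  inner f g := inner ℂ (FockSpace.toLp f) (FockSpace.toLp g)
  norm_sq_eq_re_inner f := norm_sq_eq_re_inner (𝕜 := ℂ) (FockSpace.toLp f)
  conj_inner_symm f g := inner_conj_symm (FockSpace.toLp f) (FockSpace.toLp g)
  add_left f g h := by
    simp only [map_add]
    exact inner_add_left _ _ _
  smul_left f g c := by
    simp only [map_smul]
    exact inner_smul_left _ _ _

/-! ### The Bargmann transform -/

/-- The Hilbert space `L²(ℝ) = L²(ℝ, dx)` of complex-valued functions. -/
abbrev L2R : Type := Lp ℂ 2 (volume : Measure ℝ)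

/-- The integral `(2/π)^{1/4} ∫ u(x) exp(2xz - x² - z²/2) dx`. -/
def transform (u : ℝ → ℂ) (z : ℂ) : ℂ :=
  (((2 / Real.pi) ^ (1 / 4 : ℝ) : ℝ) : ℂ) *
    ∫ x : ℝ, u x * Complex.exp (2 * (x : ℂ) * z - (x : ℂ) ^ 2 - z ^ 2 / 2)

/-! ### Multiplication by `x` and differentiation on `L²(ℝ)` -/

/-- `v = u'` in the weak sense. -/
def IsWeakDeriv (u v : ℝ → ℂ) : Prop :=
  ∀ φ : ℝ → ℝ, ContDiff ℝ ∞ φ → HasCompactSupport φ →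
    ∫ x, deriv φ x • u x = -∫ x, φ x • v x

theorem integrable_smul_of_test (u : L2R) {φ : ℝ → ℝ} (hφ : Continuous φ)
    (hc : HasCompactSupport φ) : Integrable (fun x => φ x • u x) :=
  ((Lp.memLp u).locallyIntegrable (by norm_num)).integrable_smul_left_of_hasCompactSupport hφ hc

/-- The pairs `(u, u')` with `u` and its weak derivative `u'` both in `L²(ℝ)`. -/
def derivGraph : Submodule ℂ (L2R × L2R) where
  carrier := {p | IsWeakDeriv p.1 p.2}
  add_mem' := by
    intro p q hp hq φ hφ hc
    have hφ' : Continuous (deriv φ) := hφ.continuous_deriv (by simp)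
    have e1 : ∫ x, deriv φ x • (p + q).1 x = ∫ x, (deriv φ x • p.1 x + deriv φ x • q.1 x) := by
      refine integral_congr_ae ?_
      filter_upwards [Lp.coeFn_add p.1 q.1] with x hx
      simp only [Prod.fst_add, hx, Pi.add_apply, smul_add]
    have e2 : ∫ x, φ x • (p + q).2 x = ∫ x, (φ x • p.2 x + φ x • q.2 x) := by
      refine integral_congr_ae ?_
      filter_upwards [Lp.coeFn_add p.2 q.2] with x hx
      simp only [Prod.snd_add, hx, Pi.add_apply, smul_add]
    rw [e1, e2, integral_add (integrable_smul_of_test _ hφ' hc.deriv)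
      (integrable_smul_of_test _ hφ' hc.deriv),
      integral_add (integrable_smul_of_test _ hφ.continuous hc)
      (integrable_smul_of_test _ hφ.continuous hc), hp φ hφ hc, hq φ hφ hc, neg_add]
  zero_mem' := by
    intro φ hφ hc
    have e : ∀ ψ : ℝ → ℝ, ∫ x, ψ x • (0 : L2R) x = 0 := by
      intro ψ
      simp
    simp only [Prod.fst_zero, Prod.snd_zero, e, neg_zero]
  smul_mem' := by
    intro c p hp φ hφ hc
    have e : ∀ (ψ : ℝ → ℝ) (u : L2R), ∫ x, ψ x • (c • u) x = c • ∫ x, ψ x • u x := by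
      intro ψ u
      rw [← integral_smul]
      refine integral_congr_ae ?_
      filter_upwards [Lp.coeFn_smul c u] with x hx
      simp only [hx, Pi.smul_apply]
      exact smul_comm _ _ _
    simp only [Prod.smul_fst, Prod.smul_snd, e, hp φ hφ hc, smul_neg]

theorem derivGraph_unique (p : L2R × L2R) (hp : p ∈ derivGraph) (h0 : p.1 = 0) : p.2 = 0 := by
  have hL : LocallyIntegrable (p.2 : ℝ → ℂ) := (Lp.memLp p.2).locallyIntegrable (by norm_num)
  have h := ae_eq_zero_of_integral_contDiff_smul_eq_zero hL (by
    intro φ hφ hc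
    have h1 : ∫ x, deriv φ x • p.1 x = -∫ x, φ x • p.2 x := hp φ hφ hc
    have h2 : ∫ x, deriv φ x • p.1 x = 0 := by
      rw [h0]
      simp
    rw [h2] at h1
    simpa using h1.symm)
  exact (Lp.eq_zero_iff_ae_eq_zero).2 h

/-- The unbounded operator `S u = u'` of differentiation on `L²(ℝ)`, with domain all `u ∈ L²(ℝ)`
whose weak derivative is in `L²(ℝ)`. -/
def opS : L2R →ₗ.[ℂ] L2R := derivGraph.toLinearPMap

theorem mem_graph_opS (p : L2R × L2R) : p ∈ opS.graph ↔ IsWeakDeriv p.1 p.2 := by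
  rw [opS, Submodule.toLinearPMap_graph_eq _ derivGraph_unique]
  rfl

/-- The pairs `(u, v)` in `L²(ℝ)` with `v(x) = x u(x)`. -/
def mulGraph : Submodule ℂ (L2R × L2R) where
  carrier := {p | ∀ᵐ x : ℝ, p.2 x = (x : ℂ) * p.1 x}
  add_mem' := by
    intro p q hp hq
    filter_upwards [hp, hq, Lp.coeFn_add p.1 q.1, Lp.coeFn_add p.2 q.2] with x h1 h2 h3 h4
    simp only [Prod.fst_add, Prod.snd_add, h3, h4, Pi.add_apply, h1, h2, mul_add]
  zero_mem' := by
    simp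
  smul_mem' := by
    intro c p hp
    filter_upwards [hp, Lp.coeFn_smul c p.1, Lp.coeFn_smul c p.2] with x h1 h2 h3
    simp only [Prod.smul_fst, Prod.smul_snd, h2, h3, Pi.smul_apply, h1, smul_eq_mul]
    ring

theorem mulGraph_unique (p : L2R × L2R) (hp : p ∈ mulGraph) (h0 : p.1 = 0) : p.2 = 0 := by
  refine (Lp.eq_zero_iff_ae_eq_zero).2 ?_
  have hp' : ∀ᵐ x : ℝ, p.2 x = (x : ℂ) * p.1 x := hp
  rw [h0] at hp'
  filter_upwards [hp'] with x h1
  simp [h1]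

/-- The unbounded operator `T u(x) = x u(x)` of multiplication by `x` on `L²(ℝ)`, with domain all
`u ∈ L²(ℝ)` such that `x u(x)` is in `L²(ℝ)`. -/
def opT : L2R →ₗ.[ℂ] L2R := mulGraph.toLinearPMap

theorem mem_graph_opT (p : L2R × L2R) :
    p ∈ opT.graph ↔ ∀ᵐ x : ℝ, p.2 x = (x : ℂ) * p.1 x := by
  rw [opT, Submodule.toLinearPMap_graph_eq _ mulGraph_unique]
  rfl

/-! ### Conjugation and commutators of unbounded operators -/

section Operators

variable {H K : Type*} [NormedAddCommGroup H] [InnerProductSpace ℂ H]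
  [NormedAddCommGroup K] [InnerProductSpace ℂ K]

/-- The conjugate `B A B⁻¹` of an unbounded operator `A` by a unitary `B`, with domain
all `f` such that `B⁻¹ f` is in the domain of `A`. -/
def conj (B : H ≃ₗᵢ[ℂ] K) (A : H →ₗ.[ℂ] H) : K →ₗ.[ℂ] K where
  domain := A.domain.comap (B.symm.toLinearEquiv : K →ₗ[ℂ] H)
  toFun :=
    { toFun := fun f => B (A ⟨B.symm f, f.2⟩)
      map_add' := by
        intro f g
        rw [← map_add, ← LinearPMap.map_add]
        congr 2
        exact Subtype.ext (map_add B.symm (f : K) g)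
      map_smul' := by
        intro c f
        rw [RingHom.id_apply, ← map_smul, ← LinearPMap.map_smul]
        congr 2
        exact Subtype.ext (map_smul B.symm c (f : K)) }

/-- The product `P Q` of unbounded operators, with domain all `x` in the domain of `Q`
such that `Q x` is in the domain of `P`. -/
def pcomp (P Q : H →ₗ.[ℂ] H) : H →ₗ.[ℂ] H where
  domain :=
    { carrier := {x | ∃ hx : x ∈ Q.domain, Q ⟨x, hx⟩ ∈ P.domain}
      add_mem' := by
        rintro x y ⟨hx, hx'⟩ ⟨hy, hy'⟩
        refine ⟨add_mem hx hy, ?_⟩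
        have := Q.map_add ⟨x, hx⟩ ⟨y, hy⟩
        rw [AddMemClass.mk_add_mk] at this
        rw [this]
        exact add_mem hx' hy'
      zero_mem' := ⟨zero_mem _, by
        have : Q ⟨0, zero_mem _⟩ = 0 := Q.map_zero
        rw [this]
        exact zero_mem _⟩
      smul_mem' := by
        rintro c x ⟨hx, hx'⟩
        refine ⟨Submodule.smul_mem _ c hx, ?_⟩
        have : Q ⟨c • x, Submodule.smul_mem _ c hx⟩ = c • Q ⟨x, hx⟩ := Q.map_smul c ⟨x, hx⟩
        rw [this]
        exact Submodule.smul_mem _ c hx' }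
  toFun :=
    { toFun := fun x => P ⟨Q ⟨x, x.2.choose⟩, x.2.choose_spec⟩
      map_add' := by
        intro x y
        rw [← LinearPMap.map_add]
        congr 1
        exact Subtype.ext (Q.map_add ⟨x, x.2.choose⟩ ⟨y, y.2.choose⟩)
      map_smul' := by
        intro c x
        rw [RingHom.id_apply, ← LinearPMap.map_smul]
        congr 1
        exact Subtype.ext (Q.map_smul c ⟨x, x.2.choose⟩) }

/-- The commutator `[P, Q] = P Q - Q P`, with domain all `x` for which both products
are defined. -/
def commutator (P Q : H →ₗ.[ℂ] H) : H →ₗ.[ℂ] H := pcomp P Q - pcomp Q P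

/-- An unbounded operator is the identity on its domain, and this domain is dense. -/
def IsDenselyId (A : H →ₗ.[ℂ] H) : Prop :=
  Dense (A.domain : Set H) ∧ ∀ x : A.domain, A x = x

end Operators

end

end Bargmann

namespace Bargmann

noncomputable section

/-! Unitarity. On each vertical line `z = s + it` the transform is, up to a phase and the factor
`exp (|z|² / 2)`, the Fourier transform of `u(x) exp (-(x-s)²)` at `-t/π`. Plancherel in `t` and a
Gaussian integral in `s` give the isometry on test functions; density extends it (`norm_toFock`).
The range is closed and contains every `exp (a z)`, because these are multiples of transforms of
Gaussians (`transform_kernel`). By the reproducing formula `integral_mul_exp_conj`, only `0` is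
orthogonal to all of them, so the isometry is onto.

The operator `B S B⁻¹`. For `f = Bu`, differentiation under the integral shows that `f' - z f` is
the Bargmann integral with the kernel replaced by minus its `x`-derivative (`deriv_transform_sub`).
If `u' = v` weakly, integration by parts gives `Bv = f' - z f`. Conversely, if `f' - z f` is in
`F²`, it equals `Bv` for some `v` by surjectivity. Restricting the identity to imaginary `z` gives a
Fourier identity for `u` and `v` weighted by `exp (-x²)`, which forces `u' = v` weakly
(`isWeakDeriv_of_transform_eq`).

Commutators. `(xu)' = u + x u'` holds for weak derivatives, and test functions are a dense set on
which both products are defined. Conjugation by a unitary carries the relation to `F²`. -/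

/-! ### Gaussian bounds for the kernel and differentiation under the integral -/

/-- The entire part `exp (2xz - x²)` of the Bargmann kernel. -/
def kernel (z : ℂ) (x : ℝ) : ℂ := Complex.exp (2 * (x : ℂ) * z - (x : ℂ) ^ 2)

theorem norm_kernel (z : ℂ) (x : ℝ) : ‖kernel z x‖ = Real.exp (2 * x * z.re - x ^ 2) := by
  rw [kernel, Complex.norm_exp]
  congr 1
  simp [pow_two]

/-- Completing the square: `2xr - x² = 2r² - x²/2 - (x - 2r)²/2` with `r = Re z`. The bound is
uniform on discs, as dominated convergence requires. -/
theorem norm_kernel_le {z : ℂ} {R : ℝ} (hz : ‖z‖ ≤ R) (x : ℝ) :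
    ‖kernel z x‖ ≤ Real.exp (2 * R ^ 2) * Real.exp (-(1 / 2) * x ^ 2) := by
  rw [norm_kernel, ← Real.exp_add, Real.exp_le_exp]
  have h1 : z.re ^ 2 ≤ R ^ 2 := sq_le_sq' (neg_le_of_abs_le ((Complex.abs_re_le_norm z).trans hz))
    ((Complex.re_le_norm z).trans hz)
  nlinarith [sq_nonneg (x - 2 * z.re)]

theorem abs_le_exp_sq (x : ℝ) : |x| ≤ Real.exp (1 / 4 * x ^ 2) := by
  have h := Real.add_one_le_exp (1 / 4 * x ^ 2)
  nlinarith [sq_nonneg (|x| - 2), sq_abs x]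

/-- Half of the decay `exp (-x²/2)` is spent on absorbing the factor `x`. -/
theorem norm_mul_kernel_le {z : ℂ} {R : ℝ} (hz : ‖z‖ ≤ R) (x : ℝ) :
    ‖(x : ℂ) * kernel z x‖ ≤ Real.exp (2 * R ^ 2) * Real.exp (-(1 / 4) * x ^ 2) := by
  rw [norm_mul, Complex.norm_real, Real.norm_eq_abs]
  calc |x| * ‖kernel z x‖
      ≤ Real.exp (1 / 4 * x ^ 2) * (Real.exp (2 * R ^ 2) * Real.exp (-(1 / 2) * x ^ 2)) := by
        gcongr
        · exact abs_le_exp_sq x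
        · exact norm_kernel_le hz x
    _ = _ := by
        simp only [← Real.exp_add]
        congr 1
        ring

theorem memLp_gaussian {b : ℝ} (hb : 0 < b) :
    MemLp (fun x : ℝ => Real.exp (-b * x ^ 2)) 2 volume := by
  rw [memLp_two_iff_integrable_sq (by fun_prop)]
  have := integrable_exp_neg_mul_sq (b := 2 * b) (by positivity)
  refine this.congr (Filter.Eventually.of_forall fun x => ?_)
  simp only [← Real.exp_nat_mul]
  congr 1
  push_cast
  ring

@[fun_prop]
theorem continuous_kernel (z : ℂ) : Continuous (kernel z) := by
  unfold kernel
  fun_prop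

theorem memLp_kernel (z : ℂ) : MemLp (kernel z) 2 volume :=
  ((memLp_gaussian (b := 1 / 2) (by norm_num)).const_mul (Real.exp (2 * ‖z‖ ^ 2))).of_le
    (by fun_prop) (Filter.Eventually.of_forall fun x =>
      (norm_kernel_le le_rfl x).trans (le_abs_self _))

theorem memLp_mul_kernel (z : ℂ) : MemLp (fun x : ℝ => (x : ℂ) * kernel z x) 2 volume :=
  ((memLp_gaussian (b := 1 / 4) (by norm_num)).const_mul (Real.exp (2 * ‖z‖ ^ 2))).of_le
    (by fun_prop) (Filter.Eventually.of_forall fun x =>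
      (norm_mul_kernel_le le_rfl x).trans (le_abs_self _))

theorem integrable_mul_kernel {u : ℝ → ℂ} (hu : MemLp u 2 volume) (z : ℂ) :
    Integrable (fun x => u x * kernel z x) volume :=
  hu.integrable_mul (memLp_kernel z)

theorem integrable_mul_id_kernel {u : ℝ → ℂ} (hu : MemLp u 2 volume) (z : ℂ) :
    Integrable (fun x : ℝ => u x * ((x : ℂ) * kernel z x)) volume :=
  hu.integrable_mul (memLp_mul_kernel z)

theorem hasDerivAt_kernel (x : ℝ) (z : ℂ) :
    HasDerivAt (fun z => kernel z x) (2 * ((x : ℂ) * kernel z x)) z := by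
  have h : HasDerivAt (fun z : ℂ => 2 * (x : ℂ) * z - (x : ℂ) ^ 2) (2 * (x : ℂ)) z := by
    simpa using ((hasDerivAt_id z).const_mul (2 * (x : ℂ))).sub_const ((x : ℂ) ^ 2)
  convert! h.cexp using 1
  simp only [kernel]
  ring

theorem hasDerivAt_integral_kernel {u : ℝ → ℂ} (hu : MemLp u 2 volume) (z : ℂ) :
    HasDerivAt (fun z => ∫ x, u x * kernel z x) (∫ x, u x * (2 * ((x : ℂ) * kernel z x))) z := by
  refine (hasDerivAt_integral_of_dominated_loc_of_deriv_le
    (F := fun z x => u x * kernel z x) (F' := fun z x => u x * (2 * ((x : ℂ) * kernel z x)))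
    (bound := fun x => 2 * (‖u x‖ * (Real.exp (2 * (‖z‖ + 1) ^ 2) * Real.exp (-(1 / 4) * x ^ 2))))
    (Metric.ball_mem_nhds z one_pos) ?_ (integrable_mul_kernel hu z) ?_ ?_ ?_ ?_).2
  · exact Filter.Eventually.of_forall fun w => (integrable_mul_kernel hu w).aestronglyMeasurable
  · refine ((integrable_mul_id_kernel hu z).const_mul 2).aestronglyMeasurable.congr
      (Filter.Eventually.of_forall fun x => ?_)
    ring
  · refine Filter.Eventually.of_forall fun x w hw => ?_
    have hw' : ‖w‖ ≤ ‖z‖ + 1 := by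
      have := norm_sub_norm_le w z
      have h2 : ‖w - z‖ < 1 := by simpa [dist_eq_norm] using hw
      linarith
    have := norm_mul_kernel_le hw' x
    rw [norm_mul, norm_mul 2, Complex.norm_two]
    nlinarith [mul_le_mul_of_nonneg_left this (norm_nonneg (u x))]
  · exact (hu.norm.integrable_mul
      ((memLp_gaussian (b := 1 / 4) (by norm_num)).const_mul _)).const_mul 2
  · exact Filter.Eventually.of_forall fun x w _ => (hasDerivAt_kernel x w).const_mul (u x)

/-! ### The transform as an entire function -/

theorem transform_eq (u : ℝ → ℂ) (z : ℂ) :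
    transform u z = (((2 / Real.pi) ^ (1 / 4 : ℝ) : ℝ) : ℂ) *
      (Complex.exp (-z ^ 2 / 2) * ∫ x : ℝ, u x * kernel z x) := by
  rw [transform, ← integral_const_mul (Complex.exp (-z ^ 2 / 2))]
  congr 1
  refine integral_congr_ae (Filter.Eventually.of_forall fun x => ?_)
  beta_reduce
  rw [kernel, mul_left_comm, ← Complex.exp_add]
  congr 2
  ring

theorem hasDerivAt_transform {u : ℝ → ℂ} (hu : MemLp u 2 volume) (z : ℂ) :
    HasDerivAt (transform u)
      (2 * transform (fun x => (x : ℂ) * u x) z - z * transform u z) z := by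
  have e : transform u = fun z => (((2 / Real.pi) ^ (1 / 4 : ℝ) : ℝ) : ℂ) *
      (Complex.exp (-z ^ 2 / 2) * ∫ x : ℝ, u x * kernel z x) := funext (transform_eq u)
  have h1 : HasDerivAt (fun z : ℂ => -z ^ 2 / 2) (-z) z := by
    convert! ((hasDerivAt_pow 2 z).neg.div_const 2) using 1
    simp
    ring
  have h2 : ∫ x : ℝ, u x * (2 * ((x : ℂ) * kernel z x)) =
      2 * ∫ x : ℝ, (x : ℂ) * u x * kernel z x := by
    rw [← integral_const_mul]
    congr 1
    ext x
    ring
  rw [transform_eq u z, transform_eq _ z, e]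
  convert! (h1.cexp.mul (hasDerivAt_integral_kernel hu z)).const_mul _ using 1
  rw [h2]
  ring

theorem differentiable_transform {u : ℝ → ℂ} (hu : MemLp u 2 volume) :
    Differentiable ℂ (transform u) := fun z => (hasDerivAt_transform hu z).differentiableAt

theorem transform_congr {u v : ℝ → ℂ} (h : u =ᵐ[volume] v) : transform u = transform v := by
  ext z
  rw [transform, transform]
  congr 1
  refine integral_congr_ae ?_
  filter_upwards [h] with x hx
  rw [hx]

theorem transform_add {u v : ℝ → ℂ} (hu : MemLp u 2 volume) (hv : MemLp v 2 volume) :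
    transform (u + v) = transform u + transform v := by
  ext z
  simp only [transform_eq, Pi.add_apply, add_mul]
  rw [integral_add (integrable_mul_kernel hu z) (integrable_mul_kernel hv z)]
  ring

theorem transform_smul (c : ℂ) (u : ℝ → ℂ) : transform (c • u) = c • transform u := by
  ext z
  simp only [transform_eq, Pi.smul_apply, smul_eq_mul, mul_assoc, integral_const_mul]
  ring

/-! ### Norm identity on test functions, by Plancherel on vertical lines -/

open scoped FourierTransform SchwartzMap

/-- For `z = s + it` the exponent `2xz - x² - z²/2` equals `-(x-s)² + 2ixt + (s²+t²)/2 - ist`. The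
term `2ixt` is the Fourier character at frequency `-t/π`. -/
theorem transform_eq_fourier (u : ℝ → ℂ) (s t : ℝ) :
    transform u (s + t * Complex.I) = (((2 / Real.pi) ^ (1 / 4 : ℝ) : ℝ) : ℂ) *
      (Complex.exp (((s ^ 2 + t ^ 2) / 2 : ℝ) + (-(s * t) : ℝ) * Complex.I) *
        𝓕 (fun x : ℝ => u x * (Real.exp (-(x - s) ^ 2) : ℂ)) (-Real.pi⁻¹ * t)) := by
  rw [transform, Real.fourier_real_eq_integral_exp_smul,
    ← integral_const_mul (Complex.exp _)]
  congr 1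
  refine integral_congr_ae (Filter.Eventually.of_forall fun x => ?_)
  simp only [smul_eq_mul]
  have e : ((-2 * Real.pi * x * (-Real.pi⁻¹ * t) : ℝ) : ℂ) = 2 * x * t := by
    have : -2 * Real.pi * x * (-Real.pi⁻¹ * t) = 2 * x * t := by
      field_simp
    rw [this]
    push_cast
    ring
  rw [e, Complex.ofReal_exp, mul_comm (u x), mul_comm (u x), ← mul_assoc, ← mul_assoc,
    ← Complex.exp_add, ← Complex.exp_add]
  congr 2
  push_cast
  linear_combination (-(t : ℂ) ^ 2 / 2) * Complex.I_sq

theorem norm_sq_transform (u : ℝ → ℂ) (s t : ℝ) :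
    Real.pi⁻¹ * Real.exp (-‖(s + t * Complex.I : ℂ)‖ ^ 2) * ‖transform u (s + t * Complex.I)‖ ^ 2 =
      Real.pi⁻¹ * Real.sqrt (2 / Real.pi) *
        ‖𝓕 (fun x : ℝ => u x * (Real.exp (-(x - s) ^ 2) : ℂ)) (-Real.pi⁻¹ * t)‖ ^ 2 := by
  have h1 : ‖(s + t * Complex.I : ℂ)‖ ^ 2 = s ^ 2 + t ^ 2 := by
    rw [Complex.sq_norm, Complex.normSq_add_mul_I]
  have h2 : (((2 / Real.pi) ^ (1 / 4 : ℝ) : ℝ)) ^ 2 = Real.sqrt (2 / Real.pi) := by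
    rw [← Real.rpow_natCast, ← Real.rpow_mul (by positivity), Real.sqrt_eq_rpow]
    norm_num
  rw [transform_eq_fourier, norm_mul, norm_mul, mul_pow, mul_pow, Complex.norm_real, Real.norm_eq_abs,
    sq_abs, h1, h2, Complex.norm_exp, ← Real.exp_nat_mul]
  have h3 : Real.exp (-(s ^ 2 + t ^ 2)) * Real.exp ((2 : ℕ) *
      (((s ^ 2 + t ^ 2) / 2 : ℝ) + (-(s * t) : ℝ) * Complex.I : ℂ).re) = 1 := by
    rw [← Real.exp_add, Real.exp_eq_one_iff]
    simp [-Complex.ofReal_div, -Complex.ofReal_neg, -Complex.ofReal_mul]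
    ring
  linear_combination (Real.pi⁻¹ * Real.sqrt (2 / Real.pi) *
    ‖𝓕 (fun x : ℝ => u x * (Real.exp (-(x - s) ^ 2) : ℂ)) (-Real.pi⁻¹ * t)‖ ^ 2) * h3

theorem lintegral_norm_sq_fourier (h : 𝓢(ℝ, ℂ)) :
    ∫⁻ t : ℝ, ENNReal.ofReal (‖𝓕 (h : ℝ → ℂ) (-Real.pi⁻¹ * t)‖ ^ 2) =
      ENNReal.ofReal Real.pi * ∫⁻ x, ENNReal.ofReal (‖h x‖ ^ 2) := by
  have hi : ∀ g : 𝓢(ℝ, ℂ), Integrable (fun x => ‖g x‖ ^ 2) volume := fun g =>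
    (memLp_two_iff_integrable_sq_norm g.continuous.aestronglyMeasurable).1 (g.memLp 2 volume)
  have hpi : -Real.pi⁻¹ ≠ 0 := by
    simp [Real.pi_ne_zero]
  have hF : Integrable (fun t : ℝ => ‖𝓕 (h : ℝ → ℂ) (-Real.pi⁻¹ * t)‖ ^ 2) := by
    rw [← SchwartzMap.fourier_coe]
    exact (hi (𝓕 h)).comp_mul_left' hpi
  rw [← ofReal_integral_eq_lintegral_ofReal hF (Filter.Eventually.of_forall fun _ => by positivity),
    ← ofReal_integral_eq_lintegral_ofReal (hi h) (Filter.Eventually.of_forall fun _ => by positivity),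
    ← ENNReal.ofReal_mul Real.pi_pos.le, ← SchwartzMap.integral_norm_sq_fourier,
    ← SchwartzMap.fourier_coe]
  have := Measure.integral_comp_mul_left (fun t => ‖𝓕 h t‖ ^ 2) (-Real.pi⁻¹)
  rw [this]
  simp [abs_of_pos Real.pi_pos]

theorem lintegral_gaussian_sub (x : ℝ) :
    ∫⁻ s : ℝ, ENNReal.ofReal (Real.exp (-2 * (x - s) ^ 2)) =
      ENNReal.ofReal (Real.sqrt (Real.pi / 2)) := by
  have h := integrable_exp_neg_mul_sq (b := 2) (by norm_num)
  rw [lintegral_sub_left_eq_self (fun s => ENNReal.ofReal (Real.exp (-2 * s ^ 2))) x,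
    ← ofReal_integral_eq_lintegral_ofReal h (Filter.Eventually.of_forall fun _ => by positivity),
    integral_gaussian]

theorem lintegral_gaussianMeasure {f : ℂ → ENNReal} (hf : Measurable f) :
    ∫⁻ z, f z ∂gaussianMeasure = ∫⁻ s : ℝ, ∫⁻ t : ℝ,
      ENNReal.ofReal (Real.pi⁻¹ * Real.exp (-‖(s + t * Complex.I : ℂ)‖ ^ 2)) *
        f (s + t * Complex.I) := by
  have hw : Measurable fun z : ℂ => ENNReal.ofReal (Real.pi⁻¹ * Real.exp (-‖z‖ ^ 2)) := by fun_prop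
  rw [gaussianMeasure, lintegral_withDensity_eq_lintegral_mul _ hw hf,
    ← Complex.volume_preserving_equiv_real_prod.symm.lintegral_comp (hw.mul hf),
    Measure.volume_eq_prod, lintegral_prod]
  · refine lintegral_congr fun s => lintegral_congr fun t => ?_
    have : Complex.measurableEquivRealProd.symm (s, t) = s + t * Complex.I := by
      apply Complex.ext <;> simp [Complex.measurableEquivRealProd]
    simp only [Pi.mul_apply, this]
  · exact ((hw.mul hf).comp (MeasurableEquiv.measurable _)).aemeasurable

/-- Plancherel handles the integral over `t`. After Tonelli, the integral of `exp (-2(x-s)²)` over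
`s` does not depend on `x`, and its value `√(π/2)` cancels the constant `√(2/π)`. -/
theorem lintegral_norm_sq_transform {u : ℝ → ℂ} (hc : HasCompactSupport u) (hu : ContDiff ℝ ∞ u) :
    ∫⁻ z, ENNReal.ofReal (‖transform u z‖ ^ 2) ∂gaussianMeasure =
      ∫⁻ x, ENNReal.ofReal (‖u x‖ ^ 2) := by
  have hd : Continuous (transform u) :=
    (differentiable_transform (hu.continuous.memLp_of_hasCompactSupport hc)).continuous
  have hs : ∀ s : ℝ, ∫⁻ t : ℝ,
      ENNReal.ofReal (Real.pi⁻¹ * Real.exp (-‖(s + t * Complex.I : ℂ)‖ ^ 2)) *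
        ENNReal.ofReal (‖transform u (s + t * Complex.I)‖ ^ 2) =
      ENNReal.ofReal (Real.sqrt (2 / Real.pi)) * ∫⁻ x : ℝ, ENNReal.ofReal (‖u x‖ ^ 2) *
        ENNReal.ofReal (Real.exp (-2 * (x - s) ^ 2)) := by
    intro s
    have hh1 : HasCompactSupport fun x : ℝ => u x * (Real.exp (-(x - s) ^ 2) : ℂ) := hc.mul_right
    have hh2 : ContDiff ℝ ∞ fun x : ℝ => u x * (Real.exp (-(x - s) ^ 2) : ℂ) := by
      have h : ContDiff ℝ ∞ fun x : ℝ => -(x - s) ^ 2 := by fun_prop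
      exact hu.mul (Complex.ofRealCLM.contDiff.comp (Real.contDiff_exp.comp h))
    have key := lintegral_norm_sq_fourier (hh1.toSchwartzMap hh2)
    have e : ∀ t : ℝ, ENNReal.ofReal (Real.pi⁻¹ * Real.exp (-‖(s + t * Complex.I : ℂ)‖ ^ 2)) *
        ENNReal.ofReal (‖transform u (s + t * Complex.I)‖ ^ 2) =
        ENNReal.ofReal (Real.pi⁻¹ * Real.sqrt (2 / Real.pi)) *
        ENNReal.ofReal (‖𝓕 (fun x : ℝ => u x * (Real.exp (-(x - s) ^ 2) : ℂ))
          (-Real.pi⁻¹ * t)‖ ^ 2) := by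
      intro t
      rw [← ENNReal.ofReal_mul (by positivity), norm_sq_transform, ENNReal.ofReal_mul (by positivity)]
    simp only [e]
    rw [lintegral_const_mul' _ _ ENNReal.ofReal_ne_top]
    refine (congrArg _ key).trans ?_
    rw [← mul_assoc, ← ENNReal.ofReal_mul (by positivity)]
    congr 1
    · congr 1
      field_simp
    · refine lintegral_congr fun x => ?_
      rw [← ENNReal.ofReal_mul (by positivity)]
      congr 1
      change ‖u x * (Real.exp (-(x - s) ^ 2) : ℂ)‖ ^ 2 = _
      rw [norm_mul, mul_pow, Complex.norm_real, Real.norm_eq_abs, sq_abs, ← Real.exp_nat_mul]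
      congr 2
      push_cast
      ring
  rw [lintegral_gaussianMeasure (by fun_prop)]
  simp only [hs]
  rw [lintegral_const_mul' _ _ ENNReal.ofReal_ne_top, lintegral_lintegral_swap]
  · simp only [lintegral_const_mul' _ _ ENNReal.ofReal_ne_top, lintegral_gaussian_sub]
    rw [lintegral_mul_const' _ _ ENNReal.ofReal_ne_top, mul_left_comm,
      ← ENNReal.ofReal_mul (by positivity), ← Real.sqrt_mul (by positivity)]
    have : 2 / Real.pi * (Real.pi / 2) = 1 := by field_simp
    simp [this]
  · have := hu.continuous
    have h1 : Measurable fun p : ℝ × ℝ => ENNReal.ofReal (‖u p.2‖ ^ 2) *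
        ENNReal.ofReal (Real.exp (-2 * (p.2 - p.1) ^ 2)) := by fun_prop
    exact h1.aemeasurable

theorem eLpNorm_transform {u : ℝ → ℂ} (hc : HasCompactSupport u) (hu : ContDiff ℝ ∞ u) :
    eLpNorm (transform u) 2 gaussianMeasure = eLpNorm u 2 volume := by
  have h := lintegral_norm_sq_transform hc hu
  have e : ∀ a : ℂ, ENNReal.ofReal (‖a‖ ^ 2) = ‖a‖ₑ ^ (2 : ℝ) := by
    intro a
    rw [ENNReal.ofReal_pow (norm_nonneg a), ofReal_norm, ← ENNReal.rpow_natCast]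
    norm_num
  simp only [e] at h
  rw [eLpNorm_eq_lintegral_rpow_enorm_toReal (by norm_num) (by norm_num),
    eLpNorm_eq_lintegral_rpow_enorm_toReal (by norm_num) (by norm_num)]
  simp only [ENNReal.toReal_ofNat, h]

/-! ### The transform as an isometry -/

theorem dense_contDiff_hasCompactSupport :
    Dense {u : L2R | ∃ g : ℝ → ℂ, HasCompactSupport g ∧ ContDiff ℝ ∞ g ∧ u =ᵐ[volume] g} := by
  intro u
  refine (mem_closure_iff_nhds_basis Metric.nhds_basis_closedBall).2 fun ε hε => ?_
  obtain ⟨g, hg₁, hg₂, hg₃⟩ := MemLp.exist_eLpNorm_sub_le (by norm_num) (by norm_num)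
    (Lp.memLp u) hε
  have hm : MemLp g 2 volume := hg₂.continuous.memLp_of_hasCompactSupport hg₁
  refine ⟨hm.toLp g, ⟨g, hg₁, hg₂, hm.coeFn_toLp⟩, ?_⟩
  have : (u : ℝ → ℂ) - ((hm.toLp g : L2R) : ℝ → ℂ) =ᵐ[volume] (u : ℝ → ℂ) - g := by
    filter_upwards [hm.coeFn_toLp] with x hx
    simp [hx]
  rw [Metric.mem_closedBall', Lp.dist_def, eLpNorm_congr_ae this]
  exact ENNReal.toReal_le_of_le_ofReal hε.le hg₃

/-- The value at `z` is a constant times the inner product with the conjugate kernel. Hence `L²`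
convergence implies pointwise convergence of transforms. -/
theorem continuous_transform_apply (z : ℂ) : Continuous fun u : L2R => transform u z := by
  have hk : MemLp (fun x => star (kernel z x)) 2 volume := (memLp_kernel z).star
  have e : ∀ u : L2R, ∫ x : ℝ, u x * kernel z x = inner ℂ (hk.toLp _) u := by
    intro u
    rw [L2.inner_def]
    refine integral_congr_ae ?_
    filter_upwards [hk.coeFn_toLp] with x hx
    rw [hx]
    simp
  simp only [transform_eq, e]
  fun_prop

/-- Fatou's lemma along approximating test functions. The inequality is enough for membership in
`F²`; equality follows later by continuity. -/
theorem eLpNorm_transform_le (u : L2R) :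
    eLpNorm (transform u) 2 gaussianMeasure ≤ eLpNorm u 2 volume := by
  obtain ⟨v, hv, hvu⟩ := mem_closure_iff_seq_limit.1 (dense_contDiff_hasCompactSupport u)
  have h1 : ∀ n, eLpNorm (transform (v n)) 2 gaussianMeasure = eLpNorm (v n) 2 volume := by
    intro n
    obtain ⟨g, hg₁, hg₂, hg₃⟩ := hv n
    rw [transform_congr hg₃, eLpNorm_congr_ae hg₃, eLpNorm_transform hg₁ hg₂]
  have h2 : Filter.Tendsto (fun n => eLpNorm (v n) 2 volume) Filter.atTop
      (nhds (eLpNorm u 2 volume)) := by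
    have := (continuous_enorm.tendsto u).comp hvu
    simpa only [Function.comp_def, Lp.enorm_def] using this
  rw [← h2.liminf_eq]
  simp only [← h1]
  exact Lp.eLpNorm_lim_le_liminf_eLpNorm
    (fun n => (differentiable_transform (Lp.memLp (v n))).continuous.aestronglyMeasurable) _
    (Filter.Eventually.of_forall fun z => ((continuous_transform_apply z).tendsto u).comp hvu)

theorem isFock_transform (u : L2R) : IsFock (transform u) :=
  ⟨differentiable_transform (Lp.memLp u),
    (differentiable_transform (Lp.memLp u)).continuous.aestronglyMeasurable,
    (eLpNorm_transform_le u).trans_lt (Lp.memLp u).2⟩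

theorem FockSpace.ext {f g : FockSpace} (h : ∀ z, f z = g z) : f = g :=
  Subtype.ext (funext h)

theorem FockSpace.norm_eq (f : FockSpace) : ‖f‖ = (eLpNorm f 2 gaussianMeasure).toReal :=
  Lp.norm_toLp f.1 f.isFock.2

theorem FockSpace.inner_eq (f g : FockSpace) :
    inner ℂ f g = ∫ z, starRingEnd ℂ (f z) * g z ∂gaussianMeasure := by
  change inner ℂ (FockSpace.toLp f) (FockSpace.toLp g) = _
  rw [L2.inner_def]
  refine integral_congr_ae ?_
  filter_upwards [f.isFock.2.coeFn_toLp, g.isFock.2.coeFn_toLp] with z hf hg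
  change inner ℂ (f.isFock.2.toLp _ z) (g.isFock.2.toLp _ z) = _
  rw [hf, hg]
  simp [mul_comm]

/-- The Bargmann transform as a linear map into the Fock space. -/
def toFock : L2R →ₗ[ℂ] FockSpace where
  toFun u := (⟨transform u, isFock_transform u⟩ : fockSubmodule)
  map_add' u v := Subtype.ext <|
    (transform_congr (Lp.coeFn_add u v)).trans (transform_add (Lp.memLp u) (Lp.memLp v))
  map_smul' c u := Subtype.ext <|
    (transform_congr (Lp.coeFn_smul c u)).trans (transform_smul c u)

theorem norm_toFock_le (u : L2R) : ‖toFock u‖ ≤ ‖u‖ := by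
  rw [FockSpace.norm_eq, Lp.norm_def]
  exact ENNReal.toReal_mono (Lp.memLp u).2.ne (eLpNorm_transform_le u)

theorem norm_toFock (u : L2R) : ‖toFock u‖ = ‖u‖ := by
  have hc : Continuous toFock := AddMonoidHomClass.continuous_of_bound toFock 1
    fun u => by simpa using norm_toFock_le u
  refine (isClosed_eq hc.norm continuous_norm).closure_subset_iff.2 ?_
    (dense_contDiff_hasCompactSupport u)
  rintro v ⟨g, hg₁, hg₂, hg₃⟩
  change ‖toFock v‖ = ‖v‖
  rw [FockSpace.norm_eq, Lp.norm_def, eLpNorm_congr_ae hg₃, ← eLpNorm_transform hg₁ hg₂,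
    ← transform_congr hg₃]
  rfl

/-- The Bargmann transform as a linear isometry into the Fock space. -/
def toFockIsometry : L2R →ₗᵢ[ℂ] FockSpace := ⟨toFock, norm_toFock⟩

/-! ### The reproducing formula and surjectivity -/

theorem integral_gaussianMeasure (f : ℂ → ℂ) :
    ∫ z, f z ∂gaussianMeasure =
      ∫ z, ((Real.pi⁻¹ * Real.exp (-‖z‖ ^ 2) : ℝ) : ℂ) * f z := by
  rw [gaussianMeasure, integral_withDensity_eq_integral_toReal_smul (by fun_prop)
    (Filter.Eventually.of_forall fun _ => ENNReal.ofReal_lt_top)]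
  refine integral_congr_ae (Filter.Eventually.of_forall fun z => ?_)
  simp only [Complex.real_smul]
  rw [ENNReal.toReal_ofReal (by positivity)]

theorem integrable_gaussianMeasure_iff (f : ℂ → ℂ) :
    Integrable f gaussianMeasure ↔
      Integrable (fun z => ((Real.pi⁻¹ * Real.exp (-‖z‖ ^ 2) : ℝ) : ℂ) * f z) volume := by
  rw [gaussianMeasure, integrable_withDensity_iff_integrable_smul' (by fun_prop)
    (Filter.Eventually.of_forall fun _ => ENNReal.ofReal_lt_top)]
  refine integrable_congr (Filter.Eventually.of_forall fun z => ?_)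
  simp only [Complex.real_smul]
  rw [ENNReal.toReal_ofReal (by positivity)]

instance : IsProbabilityMeasure gaussianMeasure := by
  constructor
  have h := GaussianFourier.integral_rexp_neg_mul_sq_norm (V := ℂ) one_pos
  have hi : Integrable (fun z : ℂ => Real.pi⁻¹ * Real.exp (-‖z‖ ^ 2)) := by
    -- A non-integrable function would have integral `0`, but the known Gaussian integral is
    -- nonzero.
    by_contra hn
    have : ∫ z : ℂ, Real.pi⁻¹ * Real.exp (-1 * ‖z‖ ^ 2) = 0 := by
      refine integral_undef ?_
      simpa using hn
    rw [integral_const_mul, h] at this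
    simp [Complex.finrank_real_complex, Real.pi_ne_zero] at this
  rw [gaussianMeasure, withDensity_apply _ MeasurableSet.univ, Measure.restrict_univ,
    ← ofReal_integral_eq_lintegral_ofReal hi (Filter.Eventually.of_forall fun _ => by positivity),
    integral_const_mul]
  simp only [neg_mul, one_mul] at h
  rw [h]
  simp [Complex.finrank_real_complex, Real.pi_ne_zero]

theorem measurePreserving_rotation (a : Circle) :
    MeasurePreserving (rotation a) gaussianMeasure gaussianMeasure := by
  refine ⟨(rotation a).continuous.measurable, Measure.ext fun s hs => ?_⟩
  have hm : Measurable (rotation a) := (rotation a).continuous.measurable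
  rw [Measure.map_apply hm hs, gaussianMeasure, withDensity_apply _ hs,
    withDensity_apply _ (hm hs),
    ← (rotation a).measurePreserving.setLIntegral_comp_preimage_emb
      (rotation a).toHomeomorph.measurableEmbedding _ s]
  simp only [LinearIsometryEquiv.norm_map]

theorem integral_rotation {F : ℂ → ℂ} (a : Circle) :
    ∫ z, F (a * z) ∂gaussianMeasure = ∫ z, F z ∂gaussianMeasure := by
  have := (measurePreserving_rotation a).integral_comp
    (rotation a).toHomeomorph.measurableEmbedding F
  simpa only [rotation_apply] using this

/-- The mean value property of `w ↦ F (w z)` on the unit circle, which covers `z = 0` as well. -/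
theorem circleAverage_comp_mul {F : ℂ → ℂ} (hF : Differentiable ℂ F) (z : ℂ) :
    ∫ θ in (0 : ℝ)..2 * Real.pi, F (Circle.exp θ * z) = (2 * Real.pi : ℝ) • F 0 := by
  have hd : Differentiable ℂ fun w => F (w * z) := hF.comp (by fun_prop)
  have h := (hd.diffContOnCl (s := Metric.ball 0 |1|)).circleAverage
  rw [Real.circleAverage_def] at h
  simp only [circleMap_zero, Complex.ofReal_one, one_mul, zero_mul] at h
  rw [← h, smul_inv_smul₀ (by positivity)]
  simp [Circle.coe_exp]

/-- The mean value property of entire functions for the Gaussian measure. -/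
theorem integral_gaussianMeasure_eq_apply_zero {F : ℂ → ℂ} (hF : Differentiable ℂ F)
    (hi : Integrable F gaussianMeasure) : ∫ z, F z ∂gaussianMeasure = F 0 := by
  have hle : (0 : ℝ) ≤ 2 * Real.pi := by positivity
  have hc : Continuous F := hF.continuous
  have hprod : Integrable (Function.uncurry fun (θ : ℝ) (z : ℂ) => F (Circle.exp θ * z))
      ((volume.restrict (Set.Ioc 0 (2 * Real.pi))).prod gaussianMeasure) := by
    have hcont : Continuous (Function.uncurry fun (θ : ℝ) (z : ℂ) => F (Circle.exp θ * z)) := by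
      unfold Function.uncurry
      fun_prop
    rw [integrable_prod_iff hcont.aestronglyMeasurable]
    constructor
    · refine Filter.Eventually.of_forall fun θ => ?_
      exact ((measurePreserving_rotation (Circle.exp θ)).integrable_comp_emb
        (rotation (Circle.exp θ)).toHomeomorph.measurableEmbedding).2 hi
    · have : ∀ θ : ℝ, ∫ z, ‖F (Circle.exp θ * z)‖ ∂gaussianMeasure =
          ∫ z, ‖F z‖ ∂gaussianMeasure := fun θ =>
        (measurePreserving_rotation (Circle.exp θ)).integral_comp
          (rotation (Circle.exp θ)).toHomeomorph.measurableEmbedding fun z => ‖F z‖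
      simp only [Function.uncurry, this]
      exact integrable_const _
  -- In one order the inner integral is independent of `θ` by rotation invariance; in the other it
  -- is `2π F(0)` by the mean value property on circles.
  have h := integral_integral_swap hprod
  simp only [integral_rotation] at h
  simp only [← intervalIntegral.integral_of_le hle, circleAverage_comp_mul hF] at h
  rw [integral_const] at h
  simp only [intervalIntegral.integral_const, sub_zero, probReal_univ, one_smul] at h
  exact smul_right_injective ℂ (by positivity : (2 * Real.pi : ℝ) ≠ 0) h

theorem transform_kernel (a z : ℂ) :
    transform (kernel a) z = ((2 / Real.pi : ℝ) ^ (1 / 4 : ℝ) : ℝ) *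
      (Real.pi / 2 : ℂ) ^ (1 / 2 : ℂ) * Complex.exp (a ^ 2 / 2) * Complex.exp (a * z) := by
  have h := integral_cexp_quadratic (b := -2) (by simp) (2 * (a + z)) (-z ^ 2 / 2)
  rw [neg_neg] at h
  have e : ∫ x : ℝ, kernel a x * Complex.exp (2 * (x : ℂ) * z - (x : ℂ) ^ 2 - z ^ 2 / 2) =
      ∫ x : ℝ, Complex.exp (-2 * (x : ℂ) ^ 2 + 2 * (a + z) * x + -z ^ 2 / 2) := by
    refine integral_congr_ae (Filter.Eventually.of_forall fun x => ?_)
    simp only [kernel]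
    rw [← Complex.exp_add]
    congr 1
    ring
  rw [transform, e, h, mul_assoc, mul_assoc, ← Complex.exp_add]
  congr 3
  ring

theorem transform_kernel_const_ne_zero (a : ℂ) :
    (((2 / Real.pi : ℝ) ^ (1 / 4 : ℝ) : ℝ) : ℂ) * (Real.pi / 2 : ℂ) ^ (1 / 2 : ℂ) *
      Complex.exp (a ^ 2 / 2) ≠ 0 := by
  refine mul_ne_zero (mul_ne_zero ?_ ?_) (Complex.exp_ne_zero _)
  · exact_mod_cast (by positivity : (2 / Real.pi : ℝ) ^ (1 / 4 : ℝ) ≠ 0)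
  · rw [Ne, Complex.cpow_eq_zero_iff]
    simp [Real.pi_ne_zero]

/-- Square integrability comes from the isometry, since the exponential is a multiple of the
transform of an `L²` function. -/
theorem isFock_exp (a : ℂ) : IsFock fun z => Complex.exp (a * z) := by
  have h : IsFock (transform (kernel a)) := by
    rw [← transform_congr (memLp_kernel a).coeFn_toLp]
    exact isFock_transform _
  have h2 := fockSubmodule.smul_mem ((((2 / Real.pi : ℝ) ^ (1 / 4 : ℝ) : ℝ) : ℂ) *
    (Real.pi / 2 : ℂ) ^ (1 / 2 : ℂ) * Complex.exp (a ^ 2 / 2))⁻¹ h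
  convert! h2 using 1
  ext z
  rw [Pi.smul_apply, transform_kernel, smul_eq_mul,
    inv_mul_cancel_left₀ (transform_kernel_const_ne_zero a)]

theorem conj_exp_conj_mul (w z : ℂ) :
    starRingEnd ℂ (Complex.exp (starRingEnd ℂ w * z)) = Complex.exp (w * starRingEnd ℂ z) := by
  rw [← Complex.exp_conj]
  simp

theorem integrable_mul_exp_conj {f : ℂ → ℂ} (hf : IsFock f) (w : ℂ) :
    Integrable (fun z => f z * Complex.exp (w * starRingEnd ℂ z)) gaussianMeasure := by
  have := hf.2.integrable_mul (isFock_exp (starRingEnd ℂ w)).2.star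
  refine this.congr (Filter.Eventually.of_forall fun z => ?_)
  simp [← Complex.exp_conj]

/-- The reproducing formula of the Fock space. -/
theorem integral_mul_exp_conj {f : ℂ → ℂ} (hf : IsFock f) (w : ℂ) :
    ∫ z, f z * Complex.exp (w * starRingEnd ℂ z) ∂gaussianMeasure = f w := by
  -- Since `-|z|² - z w̄ = -|z+w|² + w (z+w)‾`, translation by `w` turns the claim into the mean
  -- value property of the entire function `z ↦ f(z+w) exp (-z w̄)`, whose value at `0` is `f(w)`.
  have hpt : ∀ z : ℂ, ((Real.pi⁻¹ * Real.exp (-‖z‖ ^ 2) : ℝ) : ℂ) *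
      (f (z + w) * Complex.exp (-(z * starRingEnd ℂ w))) =
      ((Real.pi⁻¹ * Real.exp (-‖z + w‖ ^ 2) : ℝ) : ℂ) *
        (f (z + w) * Complex.exp (w * starRingEnd ℂ (z + w))) := by
    intro z
    have hn : ∀ v : ℂ, ((-‖v‖ ^ 2 : ℝ) : ℂ) = -(v * starRingEnd ℂ v) := by
      intro v
      rw [Complex.mul_conj, Complex.normSq_eq_norm_sq]
      push_cast
      rfl
    rw [Complex.ofReal_mul, Complex.ofReal_mul, Complex.ofReal_exp, Complex.ofReal_exp, hn, hn]
    have he : Complex.exp (-(z * starRingEnd ℂ z)) * Complex.exp (-(z * starRingEnd ℂ w)) =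
        Complex.exp (-((z + w) * starRingEnd ℂ (z + w))) *
          Complex.exp (w * starRingEnd ℂ (z + w)) := by
      rw [← Complex.exp_add, ← Complex.exp_add, map_add]
      congr 1
      ring
    linear_combination (Real.pi⁻¹ : ℝ) * f (z + w) * he
  have hi := (integrable_gaussianMeasure_iff _).1 (integrable_mul_exp_conj hf w)
  have h := integral_gaussianMeasure_eq_apply_zero
    (F := fun z => f (z + w) * Complex.exp (-(z * starRingEnd ℂ w)))
    ((hf.1.comp (by fun_prop)).mul (by fun_prop)) (by
      rw [integrable_gaussianMeasure_iff]
      simp only [hpt]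
      exact hi.comp_add_right w)
  rw [integral_gaussianMeasure] at h ⊢
  simp only [hpt] at h
  rw [integral_add_right_eq_self (fun z => ((Real.pi⁻¹ * Real.exp (-‖z‖ ^ 2) : ℝ) : ℂ) *
    (f z * Complex.exp (w * starRingEnd ℂ z)))] at h
  simpa using h

/-- The pairing of `g` with the transform of `kernel w̄` is a nonzero multiple of `g w`. Only the
range has to be complete, and it is, as an isometric image of `L²(ℝ)`. -/
theorem toFock_surjective : Function.Surjective toFockIsometry := by
  let K : Submodule ℂ FockSpace := LinearMap.range toFockIsometry.toLinearMap
  have hK : IsComplete (K : Set FockSpace) := by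
    have : (K : Set FockSpace) = Set.range toFockIsometry := by
      ext
      simp [K]
    rw [this]
    exact toFockIsometry.isometry.isUniformInducing.isComplete_range
  have : CompleteSpace K := completeSpace_coe_iff_isComplete.2 hK
  have hbot : Kᗮ = ⊥ := by
    rw [Submodule.eq_bot_iff]
    intro g hg
    refine FockSpace.ext fun w => ?_
    have h0 : inner ℂ (toFockIsometry ((memLp_kernel (starRingEnd ℂ w)).toLp _)) g = 0 :=
      (Submodule.mem_orthogonal K g).1 hg _ ⟨_, rfl⟩
    rw [FockSpace.inner_eq] at h0
    have e : ∀ z, toFockIsometry ((memLp_kernel (starRingEnd ℂ w)).toLp _) z =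
        transform (kernel (starRingEnd ℂ w)) z := by
      intro z
      rw [← transform_congr (memLp_kernel (starRingEnd ℂ w)).coeFn_toLp]
      rfl
    simp only [e, transform_kernel, map_mul, conj_exp_conj_mul] at h0
    simp only [mul_assoc, integral_const_mul] at h0
    simp only [mul_comm (Complex.exp _) (g _), integral_mul_exp_conj g.isFock] at h0
    have hne := (map_ne_zero (starRingEnd ℂ)).2 (transform_kernel_const_ne_zero (starRingEnd ℂ w))
    simp only [map_mul, mul_assoc] at hne
    rw [← mul_assoc, ← mul_assoc] at h0
    refine (mul_eq_zero.1 h0).resolve_left ?_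
    rwa [mul_assoc]
  have htop : K = ⊤ := (Submodule.orthogonal_eq_bot_iff).1 hbot
  exact LinearMap.range_eq_top.1 htop

/-- The Bargmann transform as a unitary operator from `L²(ℝ)` onto the Fock space. -/
def bargmann : L2R ≃ₗᵢ[ℂ] FockSpace := LinearIsometryEquiv.ofSurjective toFockIsometry toFock_surjective

theorem bargmann_apply (u : L2R) (z : ℂ) : bargmann u z = transform u z := rfl

/-! ### Graphs of conjugates and commutators -/

section Operators

variable {H K : Type*} [NormedAddCommGroup H] [InnerProductSpace ℂ H]
  [NormedAddCommGroup K] [InnerProductSpace ℂ K]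

/-- In terms of graphs, statements about partially defined operators become relations between
vectors, free of domain proofs inside arguments. -/
theorem mem_graph_conj (B : H ≃ₗᵢ[ℂ] K) (A : H →ₗ.[ℂ] H) (f g : K) :
    (f, g) ∈ (conj B A).graph ↔ (B.symm f, B.symm g) ∈ A.graph := by
  rw [LinearPMap.mem_graph_iff, LinearPMap.mem_graph_iff]
  constructor
  · rintro ⟨y, rfl, rfl⟩
    exact ⟨⟨B.symm y, y.2⟩, rfl, (B.symm_apply_apply _).symm⟩
  · rintro ⟨y, hy, h⟩
    have hf : f ∈ (conj B A).domain := by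
      change B.symm f ∈ A.domain
      rw [← show (y : H) = B.symm f from hy]
      exact y.2
    refine ⟨⟨f, hf⟩, rfl, ?_⟩
    have e : (⟨B.symm f, hf⟩ : A.domain) = y := Subtype.ext hy.symm
    change B (A ⟨B.symm f, hf⟩) = g
    rw [e, h, B.apply_symm_apply]

theorem mem_graph_pcomp (P Q : H →ₗ.[ℂ] H) (x y : H) :
    (x, y) ∈ (pcomp P Q).graph ↔ ∃ w, (x, w) ∈ Q.graph ∧ (w, y) ∈ P.graph := by
  constructor
  · intro h
    obtain ⟨a, ha, h⟩ := (LinearPMap.mem_graph_iff _).1 h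
    obtain rfl : (a : H) = x := ha
    obtain ⟨h1, h2⟩ := a.2
    refine ⟨Q ⟨a, h1⟩, Q.mem_graph ⟨a, h1⟩, ?_⟩
    have : P ⟨Q ⟨a, h1⟩, h2⟩ = y := h
    exact this ▸ P.mem_graph ⟨_, h2⟩
  · rintro ⟨w, hQ, hP⟩
    obtain ⟨a, ha, rfl⟩ := (LinearPMap.mem_graph_iff _).1 hQ
    obtain ⟨b, hb, rfl⟩ := (LinearPMap.mem_graph_iff _).1 hP
    obtain rfl : (a : H) = x := ha
    have hb' : (b : H) = Q a := hb
    have hd : (a : H) ∈ (pcomp P Q).domain := ⟨a.2, by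
      change Q a ∈ P.domain
      exact hb' ▸ b.2⟩
    have e : (pcomp P Q) ⟨a, hd⟩ = P b := by
      change P ⟨Q a, _⟩ = P b
      congr 1
      exact Subtype.ext hb'.symm
    exact (LinearPMap.mem_graph_iff _).2 ⟨⟨a, hd⟩, rfl, e⟩

theorem mem_graph_commutator (P Q : H →ₗ.[ℂ] H) (x y : H) :
    (x, y) ∈ (commutator P Q).graph ↔ ∃ a b, (x, a) ∈ (pcomp P Q).graph ∧
      (x, b) ∈ (pcomp Q P).graph ∧ y = a - b := by
  constructor
  · intro h
    obtain ⟨z, hz, h⟩ := (LinearPMap.mem_graph_iff _).1 h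
    obtain rfl : (z : H) = x := hz
    exact ⟨_, _, (pcomp P Q).mem_graph ⟨z, z.2.1⟩, (pcomp Q P).mem_graph ⟨z, z.2.2⟩, h.symm⟩
  · rintro ⟨a, b, ha, hb, rfl⟩
    obtain ⟨z, hz, rfl⟩ := (LinearPMap.mem_graph_iff _).1 ha
    obtain ⟨w, hw, rfl⟩ := (LinearPMap.mem_graph_iff _).1 hb
    obtain rfl : (z : H) = x := hz
    have hw' : (w : H) = z := hw
    have hd : (z : H) ∈ (commutator P Q).domain := ⟨z.2, hw' ▸ w.2⟩
    refine (LinearPMap.mem_graph_iff _).2 ⟨⟨z, hd⟩, rfl, ?_⟩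
    obtain rfl : w = ⟨z, hd.2⟩ := Subtype.ext hw'
    rfl

theorem isDenselyId_iff (A : H →ₗ.[ℂ] H) :
    IsDenselyId A ↔ Dense {x | ∃ y, (x, y) ∈ A.graph} ∧ ∀ x y, (x, y) ∈ A.graph → y = x := by
  have hd : (A.domain : Set H) = {x | ∃ y, (x, y) ∈ A.graph} :=
    Set.ext fun x => A.mem_domain_iff
  rw [IsDenselyId, hd]
  refine and_congr_right fun _ => ⟨fun h x y hxy => ?_, fun h x => h _ _ (A.mem_graph x)⟩
  obtain ⟨z, hz, rfl⟩ := (LinearPMap.mem_graph_iff _).1 hxy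
  exact (h z).trans hz

theorem mem_graph_commutator_conj (B : H ≃ₗᵢ[ℂ] K) (P Q : H →ₗ.[ℂ] H) (f g : K) :
    (f, g) ∈ (commutator (conj B P) (conj B Q)).graph ↔
      (B.symm f, B.symm g) ∈ (commutator P Q).graph := by
  have hp : ∀ (P Q : H →ₗ.[ℂ] H) (f g : K), (f, g) ∈ (pcomp (conj B P) (conj B Q)).graph ↔
      (B.symm f, B.symm g) ∈ (pcomp P Q).graph := by
    intro P Q f g
    simp only [mem_graph_pcomp, mem_graph_conj]
    exact B.symm.surjective.exists (p := fun w => (B.symm f, w) ∈ Q.graph ∧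
      (w, B.symm g) ∈ P.graph) |>.symm
  simp only [mem_graph_commutator, hp]
  constructor
  · rintro ⟨a, b, ha, hb, rfl⟩
    exact ⟨_, _, ha, hb, map_sub _ _ _⟩
  · rintro ⟨a, b, ha, hb, h⟩
    refine ⟨B a, B b, by simpa using ha, by simpa using hb, ?_⟩
    rw [← map_sub, ← h, B.apply_symm_apply]

theorem IsDenselyId.commutator_conj (B : H ≃ₗᵢ[ℂ] K) {P Q : H →ₗ.[ℂ] H}
    (h : IsDenselyId (commutator P Q)) : IsDenselyId (commutator (conj B P) (conj B Q)) := by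
  rw [isDenselyId_iff] at h ⊢
  simp only [mem_graph_commutator_conj]
  refine ⟨?_, fun f g hfg => B.symm.injective (h.2 _ _ hfg)⟩
  have := h.1.preimage B.symm.toHomeomorph.isOpenMap
  convert! this using 1
  ext f
  exact (B.symm.surjective.exists (p := fun w => (B.symm f, w) ∈ (commutator P Q).graph)).symm

end Operators

/-! ### The canonical commutation relation on `L²(ℝ)` -/

theorem isWeakDeriv_of_contDiff {g : ℝ → ℂ} (hc : HasCompactSupport g) (hg : ContDiff ℝ ∞ g) :
    IsWeakDeriv g (deriv g) := by
  intro φ hφ hφc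
  have hg' : Continuous (deriv g) := hg.continuous_deriv (by simp)
  have hφ' : Continuous (deriv φ) := hφ.continuous_deriv (by simp)
  have h := integral_bilinear_hasDerivAt_right_eq_neg_left_of_integrable
    (L := (ContinuousLinearMap.lsmul ℝ ℝ : ℝ →L[ℝ] ℂ →L[ℝ] ℂ)) (u := φ) (v := g)
    (u' := deriv φ) (v' := deriv g)
    (fun x _ => (hφ.differentiable (by simp) x).hasDerivAt)
    (fun x _ => (hg.differentiable (by simp) x).hasDerivAt)
    ((hφ.continuous.smul hg').integrable_of_hasCompactSupport hφc.smul_right)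
    ((hφ'.smul hg.continuous).integrable_of_hasCompactSupport hc.smul_left)
    ((hφ.continuous.smul hg.continuous).integrable_of_hasCompactSupport hφc.smul_right)
  simp only [ContinuousLinearMap.lsmul_apply] at h
  rw [h, neg_neg]

theorem IsWeakDeriv.congr {u v u' v' : ℝ → ℂ} (h : IsWeakDeriv u v) (hu : u =ᵐ[volume] u')
    (hv : v =ᵐ[volume] v') : IsWeakDeriv u' v' := by
  intro φ hφ hφc
  have h1 : ∫ x, deriv φ x • u' x = ∫ x, deriv φ x • u x := by
    refine integral_congr_ae ?_
    filter_upwards [hu] with x hx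
    rw [hx]
  have h2 : ∫ x, φ x • v' x = ∫ x, φ x • v x := by
    refine integral_congr_ae ?_
    filter_upwards [hv] with x hx
    rw [hx]
  rw [h1, h2, h φ hφ hφc]

/-- The product rule for multiplication by `x`. -/
theorem IsWeakDeriv.id_mul {u v w y : L2R} (h : IsWeakDeriv u v)
    (hw : ∀ᵐ x : ℝ, w x = (x : ℂ) * u x) (hy : ∀ᵐ x : ℝ, y x = (x : ℂ) * v x) :
    IsWeakDeriv w (u + y : L2R) := by
  intro φ hφ hφc
  -- The weak derivative of `u` is tested on `xφ`, because `x φ' = (xφ)' - φ`.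
  have hψ : ContDiff ℝ ∞ fun x : ℝ => x * φ x := contDiff_id.mul hφ
  have hψc : HasCompactSupport fun x : ℝ => x * φ x := hφc.mul_left
  have hd : ∀ x, deriv (fun x : ℝ => x * φ x) x = φ x + x * deriv φ x := by
    intro x
    have := (hasDerivAt_id x).mul (hφ.differentiable (by simp) x).hasDerivAt
    simpa using! this.deriv
  have h1 := h _ hψ hψc
  have i1 := integrable_smul_of_test u (hψ.continuous_deriv (by simp)) hψc.deriv
  have i2 := integrable_smul_of_test u hφ.continuous hφc
  have i3 := integrable_smul_of_test v hψ.continuous hψc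
  have e1 : ∫ x, deriv φ x • w x =
      ∫ x, (deriv (fun x : ℝ => x * φ x) x • u x - φ x • u x) := by
    refine integral_congr_ae ?_
    filter_upwards [hw] with x hx
    simp only [hx, hd, Complex.real_smul]
    push_cast
    ring
  have e2 : ∫ x, φ x • (u + y : L2R) x = ∫ x, (φ x • u x + (x * φ x) • v x) := by
    refine integral_congr_ae ?_
    filter_upwards [hy, Lp.coeFn_add u y] with x hx hadd
    simp only [hadd, Pi.add_apply, hx, Complex.real_smul]
    push_cast
    ring
  rw [e1, e2, integral_sub i1 i2, integral_add i2 i3, h1]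
  ring

theorem isDenselyId_commutator_opS_opT : IsDenselyId (commutator opS opT) := by
  rw [isDenselyId_iff]
  constructor
  · refine dense_contDiff_hasCompactSupport.mono ?_
    rintro u ⟨g, hc, hg, hug⟩
    have hg'c : HasCompactSupport (deriv g) := hc.deriv
    have hg' : ContDiff ℝ ∞ (deriv g) := (contDiff_infty_iff_deriv.1 hg).2
    have hx : ContDiff ℝ ∞ fun x : ℝ => (x : ℂ) := Complex.ofRealCLM.contDiff
    have hm : ∀ {k : ℝ → ℂ}, HasCompactSupport k → ContDiff ℝ ∞ k → MemLp k 2 volume :=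
      fun h1 h2 => h2.continuous.memLp_of_hasCompactSupport h1
    have hxg : ContDiff ℝ ∞ fun x : ℝ => (x : ℂ) * g x := hx.mul hg
    have hxgc : HasCompactSupport fun x : ℝ => (x : ℂ) * g x := hc.mul_left
    have hxg' : ContDiff ℝ ∞ fun x : ℝ => (x : ℂ) * deriv g x := hx.mul hg'
    have hxgc' : HasCompactSupport fun x : ℝ => (x : ℂ) * deriv g x := hg'c.mul_left
    have hdxg : ContDiff ℝ ∞ (deriv fun x : ℝ => (x : ℂ) * g x) := (contDiff_infty_iff_deriv.1 hxg).2
    refine ⟨(hm hxgc.deriv hdxg).toLp _ - (hm hxgc' hxg').toLp _,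
      (mem_graph_commutator _ _ _ _).2 ⟨_, _,
        (mem_graph_pcomp _ _ _ _).2 ⟨(hm hxgc hxg).toLp _, ?_, ?_⟩,
        (mem_graph_pcomp _ _ _ _).2 ⟨(hm hg'c hg').toLp _, ?_, ?_⟩, rfl⟩⟩
    · rw [mem_graph_opT]
      filter_upwards [(hm hxgc hxg).coeFn_toLp, hug] with x h1 h2
      rw [h1, h2]
    · rw [mem_graph_opS]
      exact (isWeakDeriv_of_contDiff hxgc hxg).congr (hm hxgc hxg).coeFn_toLp.symm
        (hm hxgc.deriv hdxg).coeFn_toLp.symm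
    · rw [mem_graph_opS]
      exact (isWeakDeriv_of_contDiff hc hg).congr hug.symm (hm hg'c hg').coeFn_toLp.symm
    · rw [mem_graph_opT]
      filter_upwards [(hm hxgc' hxg').coeFn_toLp, (hm hg'c hg').coeFn_toLp] with x h1 h2
      rw [h1, h2]
  · intro u y huy
    obtain ⟨a, b, ha, hb, rfl⟩ := (mem_graph_commutator _ _ _ _).1 huy
    obtain ⟨w, hw, hwa⟩ := (mem_graph_pcomp _ _ _ _).1 ha
    obtain ⟨v, hv, hvb⟩ := (mem_graph_pcomp _ _ _ _).1 hb
    -- The product rule gives `S(Tu) = u + T(Su)`; `S` is single-valued, so `a = u + b`.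
    have hwb : (w, u + b) ∈ opS.graph :=
      (mem_graph_opS _).2 (IsWeakDeriv.id_mul ((mem_graph_opS _).1 hv) ((mem_graph_opT _).1 hw)
        ((mem_graph_opT _).1 hvb))
    rw [opS.mem_graph_snd_inj hwa hwb rfl, add_sub_cancel_right]

/-! ### The derivative under the Bargmann transform -/

/-- Weak derivatives are tested on real functions; a complex one is split into real and imaginary
parts. -/
theorem IsWeakDeriv.integral_deriv_mul {u v : L2R} (h : IsWeakDeriv u v) {φ : ℝ → ℂ}
    (hφ : ContDiff ℝ ∞ φ) (hc : HasCompactSupport φ) :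
    ∫ x, deriv φ x * u x = -∫ x, φ x * v x := by
  have hre : ContDiff ℝ ∞ fun x => (φ x).re := Complex.reCLM.contDiff.comp hφ
  have him : ContDiff ℝ ∞ fun x => (φ x).im := Complex.imCLM.contDiff.comp hφ
  have hrec : HasCompactSupport fun x => (φ x).re := hc.comp_left Complex.zero_re
  have himc : HasCompactSupport fun x => (φ x).im := hc.comp_left Complex.zero_im
  have hd : ∀ x, HasDerivAt φ (deriv φ x) x := fun x =>
    (hφ.differentiable (by simp) x).hasDerivAt
  have hdre : ∀ x, deriv (fun x => (φ x).re) x = (deriv φ x).re := fun x =>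
    ((Complex.reCLM.hasFDerivAt).comp_hasDerivAt x (hd x)).deriv
  have hdim : ∀ x, deriv (fun x => (φ x).im) x = (deriv φ x).im := fun x =>
    ((Complex.imCLM.hasFDerivAt).comp_hasDerivAt x (hd x)).deriv
  have e1 : ∫ x, deriv φ x * u x = ∫ x, (deriv (fun x => (φ x).re) x • u x +
      Complex.I * (deriv (fun x => (φ x).im) x • u x)) := by
    congr 1
    ext x
    rw [hdre, hdim, Complex.real_smul, Complex.real_smul]
    nth_rewrite 1 [← Complex.re_add_im (deriv φ x)]
    ring
  have e2 : ∫ x, φ x * v x = ∫ x, ((φ x).re • v x + Complex.I * ((φ x).im • v x)) := by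
    congr 1
    ext x
    rw [Complex.real_smul, Complex.real_smul]
    nth_rewrite 1 [← Complex.re_add_im (φ x)]
    ring
  rw [e1, e2, integral_add, integral_add, integral_const_mul, integral_const_mul,
    h _ hre hrec, h _ him himc]
  · ring
  · exact integrable_smul_of_test _ hre.continuous hrec
  · exact (integrable_smul_of_test _ him.continuous himc).const_mul _
  · exact integrable_smul_of_test _ (hre.continuous_deriv (by simp)) hrec.deriv
  · exact (integrable_smul_of_test _ (him.continuous_deriv (by simp)) himc.deriv).const_mul _

/-- Test functions may be replaced by smooth functions that are in `L²` with their derivative. -/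
theorem IsWeakDeriv.integral_deriv_mul_of_memLp {u v : L2R} (h : IsWeakDeriv u v) {φ : ℝ → ℂ}
    (hφ : ContDiff ℝ ∞ φ) (hm : MemLp φ 2 volume) (hm' : MemLp (deriv φ) 2 volume) :
    ∫ x, deriv φ x * u x = -∫ x, φ x * v x := by
  -- The cutoffs `χ(x/(n+1))` tend to `1` pointwise. The extra term in the derivative of the product
  -- carries the factor `1/(n+1)`, so it vanishes in the limit, dominated by `C |φ u|`.
  let χ : ContDiffBump (0 : ℝ) := ⟨1, 2, one_pos, one_lt_two⟩
  have hχ : ContDiff ℝ ∞ χ := χ.contDiff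
  have hχ' : Continuous (deriv χ) := hχ.continuous_deriv (by simp)
  obtain ⟨C, hC⟩ := hχ'.bounded_above_of_compact_support χ.hasCompactSupport.deriv
  let a : ℕ → ℝ := fun n => ((n : ℝ) + 1)⁻¹
  have ha : Filter.Tendsto a Filter.atTop (nhds 0) := tendsto_inv_atTop_zero.comp
    (Filter.tendsto_atTop_add_const_right _ _ tendsto_natCast_atTop_atTop)
  have ha0 : ∀ n, 0 < a n := fun n => by positivity
  have ha1 : ∀ n, a n ≤ 1 := fun n => inv_le_one_of_one_le₀ (by simp)
  have iu : Integrable (fun x => deriv φ x * u x) := hm'.integrable_mul (Lp.memLp u)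
  have iφu : Integrable (fun x => φ x * u x) := hm.integrable_mul (Lp.memLp u)
  have iv : Integrable (fun x => φ x * v x) := hm.integrable_mul (Lp.memLp v)
  have hχc : Continuous χ := χ.continuous
  have hlim : ∀ x : ℝ, Filter.Tendsto (fun n => ((χ (a n * x) : ℝ) : ℂ)) Filter.atTop (nhds 1) := by
    intro x
    have h0 : χ (0 * x) = 1 := by
      rw [zero_mul]
      exact χ.one_of_mem_closedBall (Metric.mem_closedBall_self zero_le_one)
    have := (hχc.tendsto (0 * x)).comp (ha.mul_const x)
    rw [h0] at this
    exact_mod_cast (Complex.continuous_ofReal.tendsto 1).comp this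
  have hχ1 : ∀ x, ‖((χ x : ℝ) : ℂ)‖ ≤ 1 := by
    intro x
    rw [Complex.norm_real, Real.norm_of_nonneg χ.nonneg]
    exact χ.le_one
  have hs : ∀ n, ContDiff ℝ ∞ fun x : ℝ => ((χ (a n * x) : ℝ) : ℂ) := fun n =>
    Complex.ofRealCLM.contDiff.comp (hχ.comp (contDiff_const.mul contDiff_id))
  have hsc : ∀ n, HasCompactSupport fun x : ℝ => ((χ (a n * x) : ℝ) : ℂ) := fun n =>
    (χ.hasCompactSupport.comp_homeomorph (Homeomorph.mulLeft₀ (a n) (ha0 n).ne')).comp_left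
      Complex.ofReal_zero
  have hder : ∀ n x, deriv (fun x : ℝ => ((χ (a n * x) : ℝ) : ℂ) * φ x) x =
      ((χ (a n * x) : ℝ) : ℂ) * deriv φ x + a n * (deriv χ (a n * x) : ℝ) * φ x := by
    intro n x
    have h1 : HasDerivAt (fun x : ℝ => χ (a n * x)) (deriv χ (a n * x) * (a n * 1)) x :=
      (hχ.differentiable (by simp) (a n * x)).hasDerivAt.comp x ((hasDerivAt_id x).const_mul (a n))
    have h2 := h1.ofReal_comp.mul (hφ.differentiable (by simp) x).hasDerivAt
    refine h2.deriv.trans ?_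
    push_cast
    ring
  have key : ∀ n, ∫ x, (((χ (a n * x) : ℝ) : ℂ) * (deriv φ x * u x) +
      a n * (deriv χ (a n * x) : ℝ) * (φ x * u x)) =
      -∫ x, ((χ (a n * x) : ℝ) : ℂ) * (φ x * v x) := by
    intro n
    have := h.integral_deriv_mul ((hs n).mul hφ) (hsc n).mul_right
    simp only [hder, mul_assoc] at this
    rw [← this]
    congr 1
    ext x
    ring
  have t1 : Filter.Tendsto (fun n => ∫ x, (((χ (a n * x) : ℝ) : ℂ) * (deriv φ x * u x) +
      a n * (deriv χ (a n * x) : ℝ) * (φ x * u x))) Filter.atTop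
      (nhds (∫ x, deriv φ x * u x)) := by
    refine tendsto_integral_of_dominated_convergence
      (fun x => ‖deriv φ x * u x‖ + C * ‖φ x * u x‖) ?_ (iu.norm.add (iφu.norm.const_mul C)) ?_ ?_
    · intro n
      exact (((hs n).continuous.aestronglyMeasurable).mul iu.aestronglyMeasurable).add
        ((by fun_prop : Continuous fun x : ℝ =>
          (a n : ℂ) * (deriv χ (a n * x) : ℝ)).aestronglyMeasurable.mul iφu.aestronglyMeasurable)
    · intro n
      refine Filter.Eventually.of_forall fun x => (norm_add_le _ _).trans (add_le_add ?_ ?_)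
      · rw [norm_mul]
        exact mul_le_of_le_one_left (norm_nonneg _) (hχ1 _)
      · rw [norm_mul]
        refine mul_le_mul_of_nonneg_right ?_ (norm_nonneg _)
        rw [norm_mul, Complex.norm_real, Complex.norm_real, Real.norm_of_nonneg (ha0 n).le]
        exact (mul_le_of_le_one_left (norm_nonneg _) (ha1 n)).trans (hC _)
    · refine Filter.Eventually.of_forall fun x => ?_
      have h1 := (hlim x).mul_const (deriv φ x * u x)
      have h2 : Filter.Tendsto (fun n => (a n : ℂ) * (deriv χ (a n * x) : ℝ) * (φ x * u x))
          Filter.atTop (nhds (((0 : ℝ) : ℂ) * (deriv χ (0 * x) : ℝ) * (φ x * u x))) :=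
        (((Complex.continuous_ofReal.tendsto 0).comp ha).mul
          ((Complex.continuous_ofReal.tendsto _).comp
            ((hχ'.tendsto (0 * x)).comp (ha.mul_const x)))).mul_const _
      simpa using h1.add h2
  have t2 : Filter.Tendsto (fun n => ∫ x, ((χ (a n * x) : ℝ) : ℂ) * (φ x * v x)) Filter.atTop
      (nhds (∫ x, φ x * v x)) := by
    refine tendsto_integral_of_dominated_convergence (fun x => ‖φ x * v x‖) ?_ iv.norm ?_ ?_
    · exact fun n => ((hs n).continuous.aestronglyMeasurable).mul iv.aestronglyMeasurable
    · intro n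
      refine Filter.Eventually.of_forall fun x => ?_
      rw [norm_mul]
      exact mul_le_of_le_one_left (norm_nonneg _) (hχ1 _)
    · refine Filter.Eventually.of_forall fun x => ?_
      simpa using (hlim x).mul_const (φ x * v x)
  simp only [key] at t1
  exact tendsto_nhds_unique t1 t2.neg

theorem deriv_kernel (z : ℂ) : deriv (kernel z) = fun x : ℝ => (2 * z - 2 * x) * kernel z x := by
  ext x
  have h : HasDerivAt (fun y : ℂ => 2 * y * z - y ^ 2) (2 * z - 2 * x) x := by
    have h1 := ((hasDerivAt_id (x : ℂ)).const_mul 2).mul_const z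
    have h2 := hasDerivAt_pow 2 (x : ℂ)
    convert! h1.sub h2 using 1
    simp
  exact (h.cexp.comp_ofReal.deriv).trans (mul_comm _ _)

theorem contDiff_kernel (z : ℂ) : ContDiff ℝ ∞ (kernel z) := by
  have h : ContDiff ℝ ∞ fun x : ℝ => (x : ℂ) := Complex.ofRealCLM.contDiff
  exact Complex.contDiff_exp.comp (((contDiff_const.mul h).mul contDiff_const).sub (h.pow 2))

theorem memLp_deriv_kernel (z : ℂ) : MemLp (deriv (kernel z)) 2 volume := by
  rw [deriv_kernel]
  have := ((memLp_kernel z).const_mul (2 * z)).sub ((memLp_mul_kernel z).const_mul 2)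
  refine this.ae_eq (Filter.Eventually.of_forall fun x => ?_)
  simp only [Pi.sub_apply]
  ring

theorem deriv_transform_sub (u : L2R) (z : ℂ) :
    deriv (transform u) z - z * transform u z =
      (((2 / Real.pi) ^ (1 / 4 : ℝ) : ℝ) : ℂ) *
        (Complex.exp (-z ^ 2 / 2) * -∫ x : ℝ, deriv (kernel z) x * u x) := by
  rw [(hasDerivAt_transform (Lp.memLp u) z).deriv, transform_eq, transform_eq, deriv_kernel]
  have i1 := (integrable_mul_kernel (Lp.memLp u) z).const_mul (2 * z)
  have i2 := (integrable_mul_id_kernel (Lp.memLp u) z).const_mul 2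
  have e : ∫ x : ℝ, (2 * z - 2 * x) * kernel z x * u x =
      2 * z * (∫ x : ℝ, u x * kernel z x) - 2 * ∫ x : ℝ, (x : ℂ) * u x * kernel z x := by
    have e2 : ∫ x : ℝ, (x : ℂ) * u x * kernel z x = ∫ x : ℝ, u x * ((x : ℂ) * kernel z x) := by
      congr 1
      ext x
      ring
    rw [e2, ← integral_const_mul, ← integral_const_mul, ← integral_sub i1 i2]
    congr 1
    ext x
    ring
  rw [e]
  ring

/-- Integration by parts with the kernel as test function; it lacks compact support but is in `L²`
with its derivative. -/
theorem IsWeakDeriv.transform_eq_deriv_sub {u v : L2R} (h : IsWeakDeriv u v) (z : ℂ) :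
    transform v z = deriv (transform u) z - z * transform u z := by
  rw [deriv_transform_sub, h.integral_deriv_mul_of_memLp (contDiff_kernel z) (memLp_kernel z)
    (memLp_deriv_kernel z), neg_neg, transform_eq]
  simp only [mul_comm (kernel z _)]

/-! ### Recovering the weak derivative from the transforms -/

theorem integral_fourier_mul_eq {f g : ℝ → ℂ} (hf : Integrable f) (hg : Integrable g) :
    ∫ ξ, 𝓕 f ξ * g ξ = ∫ x, f x * 𝓕 g x := by
  simpa using! VectorFourier.integral_bilin_fourierIntegral_eq_flip
    (ContinuousLinearMap.mul ℂ ℂ) (L := innerₗ ℝ)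
    Real.continuous_fourierChar continuous_inner hf hg

/-- If the Fourier transforms of the integrable functions `U` and `W` satisfy
`Ŵ(ξ) = 2πiξ Û(ξ)`, then `W` is the weak derivative of `U`. -/
theorem integral_deriv_mul_of_fourier {U W : ℝ → ℂ} (hU : Integrable U) (hW : Integrable W)
    (h : ∀ ξ : ℝ, 𝓕 W ξ = 2 * Real.pi * Complex.I * ξ * 𝓕 U ξ) {φ : ℝ → ℂ}
    (hφ : ContDiff ℝ ∞ φ) (hc : HasCompactSupport φ) :
    ∫ x, U x * deriv φ x = -∫ x, W x * φ x := by
  -- With `φ` the Fourier transform of `η`, `φ'` is that of `-2πix η`. The multiplication formula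
  -- then moves the transforms onto `U` and `W`.
  let η : 𝓢(ℝ, ℂ) := 𝓕⁻ (hc.toSchwartzMap hφ)
  have hη : 𝓕 (η : ℝ → ℂ) = φ := by
    rw [← SchwartzMap.fourier_coe, FourierTransform.fourier_fourierInv_eq]
    rfl
  have i1 : Integrable (fun x : ℝ => x • η x) := by
    have := η.integrable_pow_mul volume 1
    rw [← integrable_norm_iff (by fun_prop)]
    simpa [norm_smul] using this
  have i2 : Integrable (fun x : ℝ => (-2 * Real.pi * Complex.I * x) • η x) := by
    refine (i1.const_mul (-2 * Real.pi * Complex.I)).congr (Filter.Eventually.of_forall fun x => ?_)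
    simp only [Complex.real_smul, smul_eq_mul]
    ring
  have hd : deriv φ = 𝓕 (fun x : ℝ => (-2 * Real.pi * Complex.I * x) • η x) := by
    rw [← hη, Real.deriv_fourier η.integrable i1]
  rw [hd, ← integral_fourier_mul_eq hU i2]
  nth_rewrite 1 [← hη]
  rw [← integral_fourier_mul_eq hW η.integrable, ← integral_neg]
  congr 1
  ext ξ
  rw [h, smul_eq_mul]
  ring

theorem kernel_zero_eq (x : ℝ) : kernel 0 x = (Real.exp (-x ^ 2) : ℂ) := by
  simp [kernel]

theorem fourier_mul_kernel_zero (u : ℝ → ℂ) (ξ : ℝ) :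
    𝓕 (fun x => u x * kernel 0 x) ξ = ∫ x, u x * kernel (-(Real.pi * ξ) * Complex.I) x := by
  rw [Real.fourier_real_eq_integral_exp_smul]
  congr 1
  ext x
  rw [kernel, kernel, smul_eq_mul, mul_left_comm, ← Complex.exp_add]
  congr 2
  push_cast
  ring

/-- At `z = -πiξ` the kernel is `exp (-x²)` times the Fourier character. The hypothesis thus says
that `U = u exp (-x²)` and `W = (v - 2xu) exp (-x²)` satisfy `Ŵ = 2πiξ Û`, hence `U' = W` weakly. -/
theorem isWeakDeriv_of_transform_eq {u v : L2R}
    (h : ∀ z, transform v z = deriv (transform u) z - z * transform u z) : IsWeakDeriv u v := by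
  have hK : ∀ z, ∫ x, v x * kernel z x = -∫ x, deriv (kernel z) x * u x := by
    intro z
    have h1 := h z
    have hc : (((2 / Real.pi) ^ (1 / 4 : ℝ) : ℝ) : ℂ) ≠ 0 := by
      exact_mod_cast (by positivity : (2 / Real.pi : ℝ) ^ (1 / 4 : ℝ) ≠ 0)
    rw [deriv_transform_sub, transform_eq] at h1
    exact mul_left_cancel₀ (Complex.exp_ne_zero _) (mul_left_cancel₀ hc h1)
  have iu : ∀ z, Integrable fun x => u x * kernel z x := integrable_mul_kernel (Lp.memLp u)
  have iv : ∀ z, Integrable fun x => v x * kernel z x := integrable_mul_kernel (Lp.memLp v)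
  have ixu : ∀ z, Integrable fun x : ℝ => u x * ((x : ℂ) * kernel z x) :=
    integrable_mul_id_kernel (Lp.memLp u)
  have hU := iu 0
  have e : ∀ z (x : ℝ), (v x - 2 * x * u x) * kernel z x =
      v x * kernel z x - 2 * (u x * ((x : ℂ) * kernel z x)) := fun z x => by ring
  have hW : Integrable fun x : ℝ => (v x - 2 * x * u x) * kernel 0 x := by
    simp only [e]
    exact (iv 0).sub ((ixu 0).const_mul 2)
  have hF : ∀ ξ : ℝ, 𝓕 (fun x : ℝ => (v x - 2 * x * u x) * kernel 0 x) ξ =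
      2 * Real.pi * Complex.I * ξ * 𝓕 (fun x => u x * kernel 0 x) ξ := by
    intro ξ
    rw [fourier_mul_kernel_zero (fun x : ℝ => v x - 2 * x * u x), fourier_mul_kernel_zero]
    set z : ℂ := -(Real.pi * ξ) * Complex.I with hz
    have e2 : ∀ x : ℝ, deriv (kernel z) x * u x =
        2 * z * (u x * kernel z x) - 2 * (u x * ((x : ℂ) * kernel z x)) := by
      intro x
      rw [deriv_kernel]
      ring
    have h1 := hK z
    simp only [e2] at h1
    rw [integral_sub ((iu z).const_mul _) ((ixu z).const_mul 2), integral_const_mul] at h1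
    simp only [e]
    rw [integral_sub (iv z) ((ixu z).const_mul 2), h1]
    have : 2 * Real.pi * Complex.I * ξ = -(2 * z) := by
      rw [hz]
      ring
    rw [this]
    ring
  intro φ hφ hφc
  -- Testing on `φ exp (x²)` removes the Gaussian weight; compact support of `φ` makes the growth
  -- harmless. The terms in `2xφu` then cancel.
  have hexp : ContDiff ℝ ∞ fun x : ℝ => Real.exp (x ^ 2) :=
    Real.contDiff_exp.comp (contDiff_id.pow 2)
  have hψ : ContDiff ℝ ∞ fun x : ℝ => ((φ x * Real.exp (x ^ 2) : ℝ) : ℂ) :=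
    Complex.ofRealCLM.contDiff.comp (hφ.mul hexp)
  have hψc : HasCompactSupport fun x : ℝ => ((φ x * Real.exp (x ^ 2) : ℝ) : ℂ) :=
    (hφc.mul_right (f' := fun x => Real.exp (x ^ 2))).comp_left Complex.ofReal_zero
  have hd : ∀ x, deriv (fun x : ℝ => ((φ x * Real.exp (x ^ 2) : ℝ) : ℂ)) x =
      ((deriv φ x + 2 * x * φ x : ℝ) : ℂ) * (Real.exp (x ^ 2) : ℂ) := by
    intro x
    have h1 := (hφ.differentiable (by simp) x).hasDerivAt.mul (hasDerivAt_pow 2 x).exp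
    refine h1.ofReal_comp.deriv.trans ?_
    push_cast
    ring
  have hone : ∀ x : ℝ, kernel 0 x * (Real.exp (x ^ 2) : ℂ) = 1 := by
    intro x
    rw [kernel_zero_eq, ← Complex.ofReal_mul, ← Real.exp_add]
    simp
  have key := integral_deriv_mul_of_fourier hU hW hF hψ hψc
  have hxφ : Continuous fun x : ℝ => 2 * x * φ x := by
    have := hφ.continuous
    fun_prop
  have j1 := integrable_smul_of_test u (hφ.continuous_deriv (by simp)) hφc.deriv
  have j2 := integrable_smul_of_test u hxφ (hφc.mul_left (f := fun x => 2 * x))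
  have j3 := integrable_smul_of_test v hφ.continuous hφc
  have k1 : ∫ x, u x * kernel 0 x * deriv (fun x : ℝ => ((φ x * Real.exp (x ^ 2) : ℝ) : ℂ)) x =
      ∫ x, (deriv φ x • u x + (2 * x * φ x) • u x) := by
    congr 1
    ext x
    rw [hd, Complex.real_smul, Complex.real_smul]
    push_cast
    have := hone x
    push_cast at this
    linear_combination u x * (((deriv φ x : ℝ) : ℂ) + 2 * x * φ x) * this
  have k2 : ∫ x : ℝ, (v x - 2 * x * u x) * kernel 0 x * ((φ x * Real.exp (x ^ 2) : ℝ) : ℂ) =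
      ∫ x, (φ x • v x - (2 * x * φ x) • u x) := by
    congr 1
    ext x
    rw [Complex.real_smul, Complex.real_smul]
    push_cast
    have := hone x
    push_cast at this
    linear_combination (v x - 2 * x * u x) * φ x * this
  rw [k1, k2, integral_add j1 j2, integral_sub j3 j2] at key
  linear_combination key

theorem mem_graph_conj_opS (f g : FockSpace) :
    (f, g) ∈ (conj bargmann opS).graph ↔ ∀ z, g z = deriv f z - z * f z := by
  rw [mem_graph_conj, mem_graph_opS]
  have hB : ∀ f : FockSpace, transform (bargmann.symm f) = f := fun f =>
    congrArg Subtype.val (bargmann.apply_symm_apply f)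
  constructor
  · intro h z
    have := h.transform_eq_deriv_sub z
    rwa [hB, hB] at this
  · intro h
    refine isWeakDeriv_of_transform_eq fun z => ?_
    rw [hB, hB]
    exact h z

end

end Bargmann

theorem theorem20 :
    ∃ B : Bargmann.L2R ≃ₗᵢ[ℂ] Bargmann.FockSpace,
      -- `B` is the Bargmann transform
      (∀ (u : Bargmann.L2R) (z : ℂ), B u z = Bargmann.transform u z) ∧
      -- the domain of `B S B⁻¹`, and its values
      (∀ f : Bargmann.FockSpace, f ∈ (Bargmann.conj B Bargmann.opS).domain ↔
        Bargmann.IsFock (fun z => deriv f z - z * f z)) ∧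
      (∀ (f : (Bargmann.conj B Bargmann.opS).domain) (z : ℂ),
        (Bargmann.conj B Bargmann.opS f) z =
          deriv (f : Bargmann.FockSpace) z - z * (f : Bargmann.FockSpace) z) ∧
      -- `[S, T] = I` on `L²(ℝ)`
      Bargmann.IsDenselyId (Bargmann.commutator Bargmann.opS Bargmann.opT) ∧
      -- `[A₂, A₁] = I` on `F²`, where `A₁ = B T B⁻¹` and `A₂ = B S B⁻¹`
      Bargmann.IsDenselyId (Bargmann.commutator (Bargmann.conj B Bargmann.opS)
        (Bargmann.conj B Bargmann.opT)) := by
  refine ⟨Bargmann.bargmann, Bargmann.bargmann_apply, fun f => ?_, fun f z => ?_,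
    Bargmann.isDenselyId_commutator_opS_opT,
    Bargmann.isDenselyId_commutator_opS_opT.commutator_conj _⟩
  · rw [LinearPMap.mem_domain_iff]
    constructor
    · rintro ⟨g, hg⟩
      rw [← funext ((Bargmann.mem_graph_conj_opS f g).1 hg)]
      exact g.isFock
    · intro h
      -- Once `f' - z f` is in `F²`, it is itself the value at `f`; surjectivity of the transform
      -- enters through the inverse of `bargmann`.
      exact ⟨(⟨_, h⟩ : Bargmann.fockSubmodule), (Bargmann.mem_graph_conj_opS f _).2 fun z => rfl⟩
  · exact (Bargmann.mem_graph_conj_opS _ _).1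
      ((Bargmann.conj Bargmann.bargmann Bargmann.opS).mem_graph f) z
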